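/- For every $m\in\mathbb N$ let $P_m$ be a probability measure under which $[0,1]$-valued p-values $p_{1,m},\dots,p_{m,m}$ of $m$ hypotheses are given, and let $\{1,\dots,m\}=I_{0,m}\,\dot\cup\,I_{1,m}$ be the nonrandom partition into true and false null hypotheses, $m_0=\#I_{0,m}$. Assume the basic independence model: the vectors $(p_{i,m})_{i\in I_{0,m}}$ and $(p_{i,m})_{i\in I_{1,m}}$ are independent, the $p_{i,m}$, $i\in I_{0,m}$, are independent and uniformly distributed on $[0,1]$, and the dependence among the $p_{i,m}$, $i\in I_{1,m}$, is arbitrary. Let $0<\alpha_1<\alpha_2\le\lambda<1$. Let $R_m(t)=\#\{i\le m: p_{i,m}\le t\}$ and $\widehat F_m(t)=R_m(t)/m$. For each level $\alpha\in(\alpha_1,\alpha_2)$ and each $m$ let $\widehat m_0=\widehat m_{0,\alpha}$ be an estimator that is a measurable function of $(\widehat F_m(t))_{t\ge\lambda}$ only (it may, but need not, depend on $\alpha$). The adaptive step-up test at level $\alpha$ has the critical values $\widehat\alpha_{i:m}=\min\{\tfrac{i}{\widehat m_0}\alpha,\lambda\}$, $0\le i\le m$. With the ordered p-values $p_{1:m}\le\dots\le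 p_{m:m}$ and $p_{0:m}:=0$ let $$R_{m,\alpha}=\max\{i\in\{0,\dots,m\}: p_{i:m}\le\widehat\alpha_{i:m}\},\qquad V_{m,\alpha}=\#\{i\in I_{0,m}: p_{i,m}\le\widehat\alpha_{R_{m,\alpha}:m}\}$$ be the numbers of rejections and of false rejections. Suppose that * (A1) $m_0/m\to\kappa_0$ for some $\kappa_0\in(0,1]$; * (A2) for every $\alpha\in(\alpha_1,\alpha_2)$ and all $m$, $\widehat m_{0,\alpha}>0$ and $\frac{\lambda}{\alpha}\widehat m_{0,\alpha}\ge R_m(\lambda)$; * (A3) for every $\alpha\in(\alpha_1,\alpha_2)$ there is $K>0$ with $\widehat m_{0,\alpha}\le Km$ for all $m$; * (consistency) for every $\alpha\in(\alpha_1,\alpha_2)$, with $0/0:=0$, $$\frac{V_{m,\alpha}}{R_{m,\alpha}}-\mathbb E\Bigl(\frac{V_{m,\alpha}}{R_{m,\alpha}}\Bigr)\to0\quad\text{in }P_m\text{-probability as } m\to\infty.$$ Then for every $\alpha\in(\alpha_1,\alpha_2)$, as $m\to\infty$, $V_{m,\alpha}\to\infty$ and $R_{m,\alpha}\to\infty$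 in $P_m$-probability, i.e. $P_m(V_{m,\alpha}\le C)\to0$ and $P_m(R_{m,\alpha}\le C)\to0$ for every $C\in\mathbb R$. -/

import Mathlib

open MeasureTheory ProbabilityTheory Filter Topology

namespace AdaptiveStepUp

noncomputable section

/-- `R_m(t)`: the number of p-values that are at most `t`. -/
def countLE {m : ℕ} (x : Fin m → ℝ) (t : ℝ) : ℕ :=
  (Finset.univ.filter fun i => x i ≤ t).card

/-- The empirical distribution function of the p-values `x`. -/
def ecdf {m : ℕ} (x : Fin m → ℝ) (t : ℝ) : ℝ := (countLE x t : ℝ) / m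

/-- The path `(F̂_m(t))_{t ≥ lam}` of the empirical distribution function. -/
def ecdfTail (lam : ℝ) {m : ℕ} (x : Fin m → ℝ) : Set.Ici lam → ℝ := fun t => ecdf x t

/-- The order statistics `x_{1:m} ≤ … ≤ x_{m:m}`, with the convention `x_{0:m} = 0`
(indices above `m` are never used). -/
def orderStat {m : ℕ} (x : Fin m → ℝ) (i : ℕ) : ℝ :=
  if h : 1 ≤ i ∧ i ≤ m then x (Tuple.sort x ⟨i - 1, by omega⟩) else 0

/-- The critical values `α_{i:m} = min {(i / m̂₀) α, lam}`; in particular `α_{0:m} = 0` if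
`lam ≥ 0`. -/
def critVal (α lam mhat : ℝ) (i : ℕ) : ℝ := min ((i : ℝ) / mhat * α) lam

/-- The number of rejections of the step-up test with critical values `c`:
the largest `i ∈ {0, …, m}` with `x_{i:m} ≤ c i`. -/
def stepUpR {m : ℕ} (x : Fin m → ℝ) (c : ℕ → ℝ) : ℕ :=
  Nat.findGreatest (fun i => orderStat x i ≤ c i) m

/-- The number of false rejections of the step-up test with critical values `c`:
hypothesis `i` is rejected iff `x i ≤ c R`, where `R` is the number of rejections. -/
def stepUpV {m : ℕ} (I0 : Finset (Fin m)) (x : Fin m → ℝ) (c : ℕ → ℝ) : ℕ :=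
  (I0.filter fun i => x i ≤ c (stepUpR x c)).card

/-- The data driven critical values of the adaptive test at level `α`, whose estimator `m̂₀` of
the number of true nulls is the functional `g` of `(F̂_m(t))_{t ≥ lam}`. -/
def adaptiveCrit (α lam : ℝ) (g : (Set.Ici lam → ℝ) → ℝ) {m : ℕ} (x : Fin m → ℝ) : ℕ → ℝ :=
  critVal α lam (g (ecdfTail lam x))

/-- `R_{m,α}`: the number of rejections of the adaptive step-up test. -/
def numRej (α lam : ℝ) (g : (Set.Ici lam → ℝ) → ℝ) {m : ℕ} (x : Fin m → ℝ) : ℕ :=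
  stepUpR x (adaptiveCrit α lam g x)

/-- `V_{m,α}`: the number of false rejections of the adaptive step-up test. -/
def numFalseRej (α lam : ℝ) (g : (Set.Ici lam → ℝ) → ℝ) {m : ℕ} (I0 : Finset (Fin m))
    (x : Fin m → ℝ) : ℕ :=
  stepUpV I0 x (adaptiveCrit α lam g x)

/-- The false discovery proportion `V_{m,α} / R_{m,α}`, with `0 / 0 = 0`. -/
def fdp (α lam : ℝ) (g : (Set.Ici lam → ℝ) → ℝ) {m : ℕ} (I0 : Finset (Fin m))
    (x : Fin m → ℝ) : ℝ :=
  (numFalseRej α lam g I0 x : ℝ) / (numRej α lam g x : ℝ)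

/-- The basic independence model: `p i` is the p-value of the `i`-th hypothesis, and `I0` is the
set of true nulls. -/
structure IsBI {Ω : Type*} [MeasurableSpace Ω] (P : Measure Ω) {m : ℕ} (I0 : Finset (Fin m))
    (p : Fin m → Ω → ℝ) : Prop where
  measurable : ∀ i, Measurable (p i)
  mem_Icc : ∀ i ω, p i ω ∈ Set.Icc (0 : ℝ) 1
  indep_blocks : IndepFun (fun ω (i : {i // i ∈ I0}) => p i ω)
    (fun ω (i : {i // i ∉ I0}) => p i ω) P
  indep_null : iIndepFun (fun (i : {i // i ∈ I0}) => p i) P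
  unif_null : ∀ i ∈ I0, ∀ t ∈ Set.Icc (0 : ℝ) 1, P {ω | p i ω ≤ t} = ENNReal.ofReal t

/-- `X_m → 0` in `P_m`-probability; each `X_m` lives on its own probability space. -/
def TendstoZeroInProb {Ω : ℕ → Type*} [∀ m, MeasurableSpace (Ω m)] (P : ∀ m, Measure (Ω m))
    (X : ∀ m, Ω m → ℝ) : Prop :=
  ∀ ε : ℝ, 0 < ε → Tendsto (fun m => P m {ω | ε ≤ |X m ω|}) atTop (𝓝 0)

/-- `X_m → ∞` in `P_m`-probability. -/
def TendstoInftyInProb {Ω : ℕ → Type*} [∀ m, MeasurableSpace (Ω m)] (P : ∀ m, Measure (Ω m))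
    (X : ∀ m, Ω m → ℝ) : Prop :=
  ∀ C : ℝ, Tendsto (fun m => P m {ω | X m ω ≤ C}) atTop (𝓝 0)

/-- Consistency of a sequence of tests with false discovery proportions `F m`:
`F m - E (F m) → 0` in `P_m`-probability. -/
def Consistent {Ω : ℕ → Type*} [∀ m, MeasurableSpace (Ω m)] (P : ∀ m, Measure (Ω m))
    (F : ∀ m, Ω m → ℝ) : Prop :=
  TendstoZeroInProb P fun m ω => F m ω - ∫ ω', F m ω' ∂(P m)

end

end AdaptiveStepUp

/-!
Each true null contributes at least `α / (K m)` to the false discovery rate: lowering its p-value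
to `0` forces a rejection, and `m̂₀ ≤ K m`. So the false discovery rate stays above some `c > 0`,
and by consistency `V ≤ (c / 2) R`, in particular `V = 0`, becomes improbable.

On the other hand, let `R ≤ C` while at least `n ≍ m` p-values are at most `lam`. Then the critical
value at `R` is at most `(C / n) lam`. Raising a p-value inside `[0, lam]` leaves `m̂₀` unchanged
and does not increase `R`, so by uniformity the true-null p-values can be pushed one after the
other above `(C / n) lam`, each at the cost of a factor `1 - C / n` in probability. Together these
factors stay bounded away from `0`, and afterwards `V = 0`. Hence `R ≤ C` is improbable, and then
so is `V ≤ C`.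
-/

namespace AdaptiveStepUp

section Resampling

variable {Ω ι : Type*} [MeasurableSpace Ω] {P : Measure Ω}

lemma indepFun_prodMk_right [IsFiniteMeasure P] {β γ δ : Type*} [MeasurableSpace β]
    [MeasurableSpace γ] [MeasurableSpace δ] {X : Ω → β} {Y : Ω → γ} {Z : Ω → δ}
    (hX : Measurable X) (hY : Measurable Y) (hZ : Measurable Z) (hXY : IndepFun X Y P)
    (hXYZ : IndepFun (fun ω => (X ω, Y ω)) Z P) : IndepFun X (fun ω => (Y ω, Z ω)) P := by
  have hYZ : IndepFun Y Z P := hXYZ.comp measurable_snd measurable_id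
  rw [indepFun_iff_map_prod_eq_prod_map_map hX.aemeasurable (by fun_prop)] at hXY ⊢
  rw [indepFun_iff_map_prod_eq_prod_map_map (by fun_prop) hZ.aemeasurable] at hXYZ hYZ
  rw [hYZ, ← Measure.prodAssoc_prod, ← hXY, ← hXYZ,
    Measure.map_map MeasurableEquiv.prodAssoc.measurable (by fun_prop)]
  rfl

lemma indepFun_compl_singleton_of_blocks [IsFiniteMeasure P] [Finite ι] {β : Type*}
    [MeasurableSpace β] {X : ι → Ω → β} (hX : ∀ i, Measurable (X i)) {s : Finset ι}
    (hblocks : IndepFun (fun ω (j : {j // j ∈ s}) => X j ω)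
      (fun ω (j : {j // j ∉ s}) => X j ω) P)
    (hs : iIndepFun (fun j : {j // j ∈ s} => X j) P) {i : ι} (hi : i ∈ s) :
    IndepFun (X i) (fun ω (j : {j // j ≠ i}) => X j ω) P := by
  classical
  let S : Finset {j // j ∈ s} := {⟨i, hi⟩}
  let T : Finset {j // j ∈ s} := Finset.univ.erase ⟨i, hi⟩
  have hST : Disjoint S T := Finset.disjoint_singleton_left.2 (Finset.notMem_erase _ _)
  have hiT : IndepFun (X i) (fun ω (j : T) => X j ω) P :=
    (hs.indepFun_finset S T hST fun j => hX j).comp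
      (φ := fun y : S → β => y ⟨⟨i, hi⟩, Finset.mem_singleton_self _⟩)
      (measurable_pi_apply _) measurable_id
  have hiTs : IndepFun (fun ω => (X i ω, fun j : T => X j ω))
      (fun ω (j : {j // j ∉ s}) => X j ω) P :=
    hblocks.comp (φ := fun y : {j // j ∈ s} → β => (y ⟨i, hi⟩, fun j : T => y j))
      (by fun_prop) measurable_id
  let glue : (T → β) × ({j // j ∉ s} → β) → {j // j ≠ i} → β := fun q j =>
    if hj : (j : ι) ∈ s then q.1 ⟨⟨j, hj⟩, by simpa [T] using j.2⟩ else q.2 ⟨j, hj⟩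
  have hglue : Measurable glue := measurable_pi_lambda _ fun j => by
    by_cases hj : (j : ι) ∈ s
    · simp only [glue, dif_pos hj]
      fun_prop
    · simp only [glue, dif_neg hj]
      fun_prop
  have h := (indepFun_prodMk_right (hX i) (measurable_pi_lambda _ fun j : T => hX j)
    (measurable_pi_lambda _ fun j : {j // j ∉ s} => hX j) hiT hiTs).comp measurable_id hglue
  convert! h using 1
  ext ω j
  by_cases hj : (j : ι) ∈ s <;> simp [glue, hj]

/-- The `i`-th coordinate of the random vector `X` is uniform on `[0, 1]` and independent of the
others, encoded as invariance of the law of `X` under resampling that coordinate. -/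
def HasUniformCoord [DecidableEq ι] (P : Measure Ω) (X : Ω → ι → ℝ) (i : ι) : Prop :=
  IdentDistrib X (fun q : Ω × ℝ => Function.update (X q.1) i q.2) P
    (P.prod (volume.restrict (Set.Icc 0 1)))

lemma hasUniformCoord_of_indepFun [DecidableEq ι] [Finite ι] [IsFiniteMeasure P] {X : Ω → ι → ℝ}
    (hX : Measurable X) {i : ι} (hunif : P.map (fun ω => X ω i) = volume.restrict (Set.Icc 0 1))
    (hindep : IndepFun (fun ω => X ω i) (fun ω (j : {j // j ≠ i}) => X ω j) P) :
    HasUniformCoord P X i := by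
  have hY : Measurable fun ω (j : {j // j ≠ i}) => X ω j := by fun_prop
  have hglue : Measurable (Homeomorph.funSplitAt ℝ i).symm :=
    (Homeomorph.funSplitAt ℝ i).symm.continuous.measurable
  have hsplit : IdentDistrib (fun ω => (X ω i, fun j : {j // j ≠ i} => X ω j))
      (fun q : Ω × ℝ => (q.2, fun j : {j // j ≠ i} => X q.1 j)) P
      (P.prod (volume.restrict (Set.Icc 0 1))) := by
    refine ⟨by fun_prop, by fun_prop, ?_⟩
    rw [(indepFun_iff_map_prod_eq_prod_map_map (by fun_prop) (by fun_prop)).1 hindep, hunif]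
    calc (volume.restrict (Set.Icc (0 : ℝ) 1)).prod (P.map fun ω (j : {j // j ≠ i}) => X ω j)
        = ((P.map fun ω (j : {j // j ≠ i}) => X ω j).prod
            ((volume.restrict (Set.Icc (0 : ℝ) 1)).map id)).map Prod.swap := by
          rw [Measure.map_id, Measure.prod_swap]
      _ = _ := by
          rw [Measure.map_prod_map _ _ hY measurable_id,
            Measure.map_map measurable_swap (hY.prodMap measurable_id)]
          rfl
  have hX_eq : X = (Homeomorph.funSplitAt ℝ i).symm ∘
      fun ω => (X ω i, fun j : {j // j ≠ i} => X ω j) :=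
    funext fun ω => ((Homeomorph.funSplitAt ℝ i).symm_apply_apply (X ω)).symm
  have hupdate_eq : (fun q : Ω × ℝ => Function.update (X q.1) i q.2) =
      (Homeomorph.funSplitAt ℝ i).symm ∘ fun q => (q.2, fun j : {j // j ≠ i} => X q.1 j) := by
    ext q j
    by_cases hj : j = i
    · subst hj; simp [Homeomorph.funSplitAt, Homeomorph.piSplitAt]
    · simp [hj]
  rw [HasUniformCoord, hupdate_eq]
  nth_rw 1 [hX_eq]
  exact hsplit.comp hglue

variable [DecidableEq ι] {X : Ω → ι → ℝ} {i : ι}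

/-- The event `E` persists when the `i`-th coordinate is raised to a level not above `lam`. -/
def IsRaisingClosed (lam : ℝ) (i : ι) (E : Set (ι → ℝ)) : Prop :=
  ∀ ⦃x : ι → ℝ⦄ ⦃s t : ℝ⦄, s ≤ t → t ≤ lam → Function.update x i s ∈ E → Function.update x i t ∈ E

lemma IsRaisingClosed.inter_lt {lam : ℝ} {E : Set (ι → ℝ)} (hE : IsRaisingClosed lam i E) (a : ℝ)
    (j : ι) : IsRaisingClosed lam i (E ∩ {x | a < x j}) := by
  rintro x s t hst ht ⟨hxE, hxj⟩
  refine ⟨hE hst ht hxE, ?_⟩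
  rcases eq_or_ne j i with rfl | hji
  · simp_all only [Set.mem_ofPred_eq, Function.update_self]
    exact hxj.trans_le hst
  · simpa [hji] using hxj

lemma HasUniformCoord.measure_eq_lintegral [SFinite P] (hX : HasUniformCoord P X i)
    {E : Set (ι → ℝ)} (hE : MeasurableSet E) :
    P {ω | X ω ∈ E} = ∫⁻ ω, volume ({t | Function.update (X ω) i t ∈ E} ∩ Set.Icc 0 1) ∂P := by
  have hupdate (ω : Ω) : Measurable fun t : ℝ => Function.update (X ω) i t := by fun_prop
  let S : Set (Ω × ℝ) := {q | Function.update (X q.1) i q.2 ∈ E}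
  have hS : NullMeasurableSet S (P.prod (volume.restrict (Set.Icc 0 1))) :=
    hX.aemeasurable_snd.nullMeasurableSet_preimage hE
  calc P {ω | X ω ∈ E}
      = P.prod (volume.restrict (Set.Icc 0 1)) S := hX.measure_mem_eq hE
    _ = ∫⁻ ω, (∫⁻ t in Set.Icc (0 : ℝ) 1, S.indicator 1 (ω, t)) ∂P := by
        rw [← lintegral_indicator_one₀ hS]
        exact lintegral_prod _ (aemeasurable_const.indicator₀ hS)
    _ = ∫⁻ ω, volume ({t | Function.update (X ω) i t ∈ E} ∩ Set.Icc 0 1) ∂P :=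
        lintegral_congr fun ω =>
          (lintegral_indicator_one (hupdate ω hE)).trans (Measure.restrict_apply (hupdate ω hE))

-- If the fibre of `E` meets `[0, θ * lam]`, then it contains all of `(θ * lam, lam]`.
lemma IsRaisingClosed.volume_update_le {lam θ : ℝ} {E : Set (ι → ℝ)}
    (hE : IsRaisingClosed lam i E) (hlam : lam ∈ Set.Icc (0 : ℝ) 1) (hθ : θ ∈ Set.Icc (0 : ℝ) 1)
    (x : ι → ℝ) :
    ENNReal.ofReal (1 - θ) *
        volume ({t | Function.update x i t ∈ E ∩ {y | y i ≤ θ * lam}} ∩ Set.Icc 0 1) ≤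
      ENNReal.ofReal θ *
        volume ({t | Function.update x i t ∈ E ∩ {y | θ * lam < y i}} ∩ Set.Icc 0 1) := by
  by_cases hex : ∃ s ≤ θ * lam, Function.update x i s ∈ E
  · obtain ⟨s, hs, hsE⟩ := hex
    have hlow : volume ({t | Function.update x i t ∈ E ∩ {y | y i ≤ θ * lam}} ∩ Set.Icc 0 1) ≤
        ENNReal.ofReal (θ * lam) := by
      rw [← sub_zero (θ * lam), ← Real.volume_Icc, sub_zero]
      exact measure_mono fun t ht => ⟨ht.2.1, by simpa using ht.1.2⟩
    have hhigh : ENNReal.ofReal ((1 - θ) * lam) ≤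
        volume ({t | Function.update x i t ∈ E ∩ {y | θ * lam < y i}} ∩ Set.Icc 0 1) := by
      rw [show (1 - θ) * lam = lam - θ * lam by ring, ← Real.volume_Ioc]
      refine measure_mono fun t ht => ⟨⟨hE (hs.trans ht.1.le) ht.2 hsE, by simpa using ht.1⟩, ?_⟩
      exact ⟨(mul_nonneg hθ.1 hlam.1).trans ht.1.le, ht.2.trans hlam.2⟩
    calc _ ≤ ENNReal.ofReal (1 - θ) * ENNReal.ofReal (θ * lam) := by gcongr
      _ = ENNReal.ofReal θ * ENNReal.ofReal ((1 - θ) * lam) := by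
        rw [← ENNReal.ofReal_mul (sub_nonneg.2 hθ.2), ← ENNReal.ofReal_mul hθ.1]
        ring_nf
      _ ≤ _ := by gcongr
  · have hempty : {t | Function.update x i t ∈ E ∩ {y | y i ≤ θ * lam}} = ∅ :=
      Set.eq_empty_of_forall_notMem fun t ht => hex ⟨t, by simpa using ht.2, ht.1⟩
    rw [hempty, Set.empty_inter, measure_empty, mul_zero]
    exact zero_le

lemma HasUniformCoord.mul_measure_le_inter_lt [SFinite P] (hX : HasUniformCoord P X i)
    {lam θ : ℝ} {E : Set (ι → ℝ)} (hE : MeasurableSet E) (hEi : IsRaisingClosed lam i E)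
    (hlam : lam ∈ Set.Icc (0 : ℝ) 1) (hθ : θ ∈ Set.Icc (0 : ℝ) 1) :
    ENNReal.ofReal (1 - θ) * P {ω | X ω ∈ E} ≤ P {ω | X ω ∈ E ∩ {x | θ * lam < x i}} := by
  have hEle : MeasurableSet (E ∩ {x | x i ≤ θ * lam}) :=
    hE.inter (measurableSet_le (by fun_prop) measurable_const)
  have hElt : MeasurableSet (E ∩ {x | θ * lam < x i}) :=
    hE.inter (measurableSet_lt measurable_const (by fun_prop))
  have hlow : ENNReal.ofReal (1 - θ) * P {ω | X ω ∈ E ∩ {x | x i ≤ θ * lam}} ≤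
      ENNReal.ofReal θ * P {ω | X ω ∈ E ∩ {x | θ * lam < x i}} := by
    rw [hX.measure_eq_lintegral hEle, hX.measure_eq_lintegral hElt,
      ← lintegral_const_mul' _ _ ENNReal.ofReal_ne_top,
      ← lintegral_const_mul' _ _ ENNReal.ofReal_ne_top]
    exact lintegral_mono fun ω => hEi.volume_update_le hlam hθ (X ω)
  have hsplit : {ω | X ω ∈ E} ⊆
      {ω | X ω ∈ E ∩ {x | x i ≤ θ * lam}} ∪ {ω | X ω ∈ E ∩ {x | θ * lam < x i}} := fun ω hω =>
    (le_or_gt (X ω i) (θ * lam)).imp (fun h => ⟨hω, h⟩) fun h => ⟨hω, h⟩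
  calc ENNReal.ofReal (1 - θ) * P {ω | X ω ∈ E}
      ≤ ENNReal.ofReal (1 - θ) * (P {ω | X ω ∈ E ∩ {x | x i ≤ θ * lam}} +
          P {ω | X ω ∈ E ∩ {x | θ * lam < x i}}) := by
        gcongr
        exact (measure_mono hsplit).trans (measure_union_le _ _)
    _ ≤ ENNReal.ofReal θ * P {ω | X ω ∈ E ∩ {x | θ * lam < x i}} +
          ENNReal.ofReal (1 - θ) * P {ω | X ω ∈ E ∩ {x | θ * lam < x i}} := by
        rw [mul_add]
        gcongr
    _ = P {ω | X ω ∈ E ∩ {x | θ * lam < x i}} := by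
        rw [← add_mul, ← ENNReal.ofReal_add hθ.1 (sub_nonneg.2 hθ.2), add_sub_cancel,
          ENNReal.ofReal_one, one_mul]

lemma pow_mul_measure_le_inter_forall_lt [SFinite P] {lam θ : ℝ} (hlam : lam ∈ Set.Icc (0 : ℝ) 1)
    (hθ : θ ∈ Set.Icc (0 : ℝ) 1) (S : Finset ι) (hX : ∀ i ∈ S, HasUniformCoord P X i)
    {E : Set (ι → ℝ)} (hE : MeasurableSet E) (hES : ∀ i ∈ S, IsRaisingClosed lam i E) :
    ENNReal.ofReal (1 - θ) ^ S.card * P {ω | X ω ∈ E} ≤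
      P {ω | X ω ∈ E ∩ {x | ∀ i ∈ S, θ * lam < x i}} := by
  induction S using Finset.induction_on generalizing E with
  | empty => simp
  | insert i S hiS ih =>
    rw [Finset.forall_mem_insert] at hX hES
    have hElt : MeasurableSet (E ∩ {x | θ * lam < x i}) :=
      hE.inter (measurableSet_lt measurable_const (by fun_prop))
    calc ENNReal.ofReal (1 - θ) ^ (insert i S).card * P {ω | X ω ∈ E}
        = ENNReal.ofReal (1 - θ) ^ S.card * (ENNReal.ofReal (1 - θ) * P {ω | X ω ∈ E}) := by
          rw [Finset.card_insert_of_notMem hiS, pow_succ, mul_assoc]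
      _ ≤ ENNReal.ofReal (1 - θ) ^ S.card * P {ω | X ω ∈ E ∩ {x | θ * lam < x i}} := by
          gcongr
          exact hX.1.mul_measure_le_inter_lt hE hES.1 hlam hθ
      _ ≤ P {ω | X ω ∈ E ∩ {x | θ * lam < x i} ∩ {x | ∀ i ∈ S, θ * lam < x i}} :=
          ih hX.2 hElt fun j hj => (hES.2 j hj).inter_lt _ i
      _ = P {ω | X ω ∈ E ∩ {x | ∀ j ∈ insert i S, θ * lam < x j}} := by
          simp only [Set.mem_inter_iff, Set.mem_ofPred_eq, Finset.forall_mem_insert, and_assoc]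

end Resampling

section StepUp

variable {m : ℕ}

lemma countLE_le (x : Fin m → ℝ) (t : ℝ) : countLE x t ≤ m := by
  simpa [countLE] using Finset.card_filter_le (Finset.univ : Finset (Fin m)) fun i => x i ≤ t

lemma countLE_mono (x : Fin m → ℝ) : Monotone (countLE x) := fun _ _ h =>
  Finset.card_le_card (Finset.monotone_filter_right _ fun _ _ hi => hi.trans h)

lemma countLE_anti {x y : Fin m → ℝ} (h : x ≤ y) (t : ℝ) : countLE y t ≤ countLE x t :=
  Finset.card_le_card (Finset.monotone_filter_right _ fun i _ hi => (h i).trans hi)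

lemma countLE_update_eq (x : Fin m → ℝ) (i : Fin m) {s s' t : ℝ} (hs : s ≤ t) (hs' : s' ≤ t) :
    countLE (Function.update x i s) t = countLE (Function.update x i s') t := by
  unfold countLE
  congr 1
  ext j
  rcases eq_or_ne j i with rfl | hj <;> simp [*]

lemma measurable_countLE {c : (Fin m → ℝ) → ℝ} (hc : Measurable c) :
    Measurable fun x : Fin m → ℝ => countLE x (c x) := by
  simp only [countLE, Finset.card_filter]
  exact Finset.measurable_sum _ fun i _ =>
    Measurable.ite (measurableSet_le (measurable_pi_apply i) hc) measurable_const measurable_const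

lemma ecdfTail_update_eq (x : Fin m → ℝ) (i : Fin m) {s s' lam : ℝ} (hs : s ≤ lam)
    (hs' : s' ≤ lam) :
    ecdfTail lam (Function.update x i s) = ecdfTail lam (Function.update x i s') := by
  ext ⟨t, ht⟩
  simp only [ecdfTail, ecdf]
  rw [countLE_update_eq x i (hs.trans ht) (hs'.trans ht)]

lemma measurable_ecdfTail (lam : ℝ) : Measurable fun x : Fin m → ℝ => ecdfTail lam x :=
  measurable_pi_lambda _ fun _ =>
    (measurable_from_nat.comp (measurable_countLE measurable_const)).div_const _

lemma orderStat_le_iff (x : Fin m → ℝ) {i : ℕ} (hi : 1 ≤ i) (him : i ≤ m) (t : ℝ) :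
    orderStat x i ≤ t ↔ i ≤ countLE x t := by
  have hsorted := Tuple.lt_card_le_iff_apply_le_of_monotone (f := x ∘ Tuple.sort x) (a := t)
    (j := ⟨i - 1, by omega⟩) (Tuple.monotone_sort x)
  have hcard : (Finset.univ.filter fun j => (x ∘ Tuple.sort x) j ≤ t).card = countLE x t :=
    Finset.card_equiv (Tuple.sort x) (by simp)
  rw [hcard] at hsorted
  rw [orderStat, dif_pos ⟨hi, him⟩, ← Function.comp_apply (f := x), ← hsorted]
  simp only
  omega

lemma stepUpR_eq (x : Fin m → ℝ) (c : ℕ → ℝ) :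
    stepUpR x c = Nat.findGreatest (fun i => i ≤ countLE x (c i)) m := by
  have hiff {i : ℕ} (hi : 0 < i) (him : i ≤ m) : orderStat x i ≤ c i ↔ i ≤ countLE x (c i) :=
    orderStat_le_iff x hi him _
  refine (Nat.findGreatest_eq_iff).2 ⟨Nat.findGreatest_le m, ?_, ?_⟩
  · intro h
    exact (hiff (Nat.pos_of_ne_zero h) (Nat.findGreatest_le m)).2
      (Nat.findGreatest_of_ne_zero (P := fun i => i ≤ countLE x (c i)) rfl h)
  · intro n hn hnm
    rw [hiff (Nat.zero_lt_of_lt hn) hnm]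
    exact Nat.findGreatest_is_greatest (P := fun i => i ≤ countLE x (c i)) hn hnm

lemma stepUpR_le_countLE (x : Fin m → ℝ) (c : ℕ → ℝ) :
    stepUpR x c ≤ countLE x (c (stepUpR x c)) := by
  rcases Nat.eq_zero_or_pos (stepUpR x c) with h | h
  · simp [h]
  · exact Nat.findGreatest_of_ne_zero (P := fun i => i ≤ countLE x (c i))
      (stepUpR_eq x c).symm h.ne'

lemma le_stepUpR {x : Fin m → ℝ} {c : ℕ → ℝ} {k : ℕ} (h : k ≤ countLE x (c k)) :
    k ≤ stepUpR x c := by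
  rw [stepUpR_eq]
  exact Nat.le_findGreatest (h.trans (countLE_le _ _)) h

lemma stepUpR_anti {x y : Fin m → ℝ} (h : x ≤ y) (c : ℕ → ℝ) : stepUpR y c ≤ stepUpR x c :=
  le_stepUpR ((stepUpR_le_countLE y c).trans (countLE_anti h _))

end StepUp

section AdaptiveTest

variable {m : ℕ} {α lam : ℝ} {g : (Set.Ici lam → ℝ) → ℝ}

lemma adaptiveCrit_le (x : Fin m → ℝ) (k : ℕ) : adaptiveCrit α lam g x k ≤ lam :=
  min_le_right _ _

-- The estimator only sees the p-values through `F̂(t)`, `t ≥ lam`, so it cannot distinguish two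
-- values of a p-value that are both at most `lam`.
lemma adaptiveCrit_update_eq (x : Fin m → ℝ) (i : Fin m) {s s' : ℝ} (hs : s ≤ lam)
    (hs' : s' ≤ lam) :
    adaptiveCrit α lam g (Function.update x i s) =
      adaptiveCrit α lam g (Function.update x i s') := by
  rw [adaptiveCrit, adaptiveCrit, ecdfTail_update_eq x i hs hs']

lemma numRej_le_countLE (x : Fin m → ℝ) : numRej α lam g x ≤ countLE x lam :=
  (stepUpR_le_countLE x _).trans (countLE_mono x (adaptiveCrit_le x _))

lemma numRej_update_anti (x : Fin m → ℝ) (i : Fin m) {s s' : ℝ} (h : s ≤ s') (hs' : s' ≤ lam) :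
    numRej α lam g (Function.update x i s') ≤ numRej α lam g (Function.update x i s) := by
  rw [numRej, numRej, adaptiveCrit_update_eq x i hs' (h.trans hs')]
  exact stepUpR_anti (update_le_update_iff.2 ⟨h, fun _ _ => le_rfl⟩) _

lemma numRej_update_eq (x : Fin m → ℝ) (i : Fin m) {s t : ℝ} (hst : s ≤ t)
    (ht : t ≤ adaptiveCrit α lam g (Function.update x i s)
      (numRej α lam g (Function.update x i s))) :
    numRej α lam g (Function.update x i t) = numRej α lam g (Function.update x i s) := by
  have htlam : t ≤ lam := ht.trans (adaptiveCrit_le _ _)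
  refine le_antisymm (numRej_update_anti x i hst htlam) (le_stepUpR ?_)
  rw [adaptiveCrit_update_eq x i htlam (hst.trans htlam), countLE_update_eq x i ht (hst.trans ht)]
  exact stepUpR_le_countLE _ _

/-- The contribution of hypothesis `i` to the false discovery proportion if `i` is a true null:
the reciprocal of the number of rejections if `i` is rejected, and `0` otherwise. -/
noncomputable def rejWeight (α lam : ℝ) (g : (Set.Ici lam → ℝ) → ℝ) (i : Fin m)
    (x : Fin m → ℝ) : ℝ :=
  if x i ≤ adaptiveCrit α lam g x (numRej α lam g x) then (numRej α lam g x : ℝ)⁻¹ else 0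

lemma rejWeight_nonneg (i : Fin m) (x : Fin m → ℝ) : 0 ≤ rejWeight α lam g i x := by
  unfold rejWeight
  positivity

lemma rejWeight_le_one (i : Fin m) (x : Fin m → ℝ) : rejWeight α lam g i x ≤ 1 := by
  unfold rejWeight
  split_ifs
  · exact Nat.cast_inv_le_one _
  · exact zero_le_one

lemma fdp_eq_sum_rejWeight (I0 : Finset (Fin m)) (x : Fin m → ℝ) :
    fdp α lam g I0 x = ∑ i ∈ I0, rejWeight α lam g i x := by
  simp only [rejWeight]
  rw [← Finset.sum_filter, Finset.sum_const, nsmul_eq_mul]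
  rfl

section Measurability

variable (hg : Measurable g)
include hg

lemma measurable_adaptiveCrit {k : (Fin m → ℝ) → ℕ} (hk : Measurable k) :
    Measurable fun x : Fin m → ℝ => adaptiveCrit α lam g x (k x) :=
  (((measurable_from_nat.comp hk).div (hg.comp (measurable_ecdfTail lam))).mul_const α).min
    measurable_const

lemma measurable_numRej : Measurable fun x : Fin m → ℝ => numRej α lam g x := by
  simp only [numRej, stepUpR_eq]
  exact measurable_findGreatest fun k _ => measurableSet_le measurable_const
    (measurable_countLE (measurable_adaptiveCrit hg measurable_const))

lemma measurableSet_rejected (i : Fin m) :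
    MeasurableSet {x : Fin m → ℝ | x i ≤ adaptiveCrit α lam g x (numRej α lam g x)} :=
  measurableSet_le (measurable_pi_apply i) (measurable_adaptiveCrit hg (measurable_numRej hg))

lemma measurable_rejWeight (i : Fin m) : Measurable (rejWeight α lam g i) :=
  Measurable.ite (measurableSet_rejected hg i) (measurable_from_nat.comp (measurable_numRej hg)).inv
    measurable_const

end Measurability

/-- The bounds on the estimator of the number of true nulls, at the vector `x` of p-values. -/
structure IsAdmissibleAt (α lam K : ℝ) (g : (Set.Ici lam → ℝ) → ℝ) (x : Fin m → ℝ) : Prop where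
  pos : 0 < g (ecdfTail lam x)
  countLE_le : (countLE x lam : ℝ) ≤ lam / α * g (ecdfTail lam x)
  le : g (ecdfTail lam x) ≤ K * m

variable {K : ℝ}

lemma IsAdmissibleAt.update {x : Fin m → ℝ} {i : Fin m} {s s' : ℝ}
    (h : IsAdmissibleAt α lam K g (Function.update x i s)) (hs : s ≤ lam) (hs' : s' ≤ lam) :
    IsAdmissibleAt α lam K g (Function.update x i s') := by
  obtain ⟨hpos, hlower, hupper⟩ := h
  rw [ecdfTail_update_eq x i hs hs'] at hpos hlower hupper
  rw [countLE_update_eq x i hs hs'] at hlower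
  exact ⟨hpos, hlower, hupper⟩

lemma measurableSet_isAdmissibleAt (hg : Measurable g) :
    MeasurableSet {x : Fin m → ℝ | IsAdmissibleAt α lam K g x} := by
  have hgx : Measurable fun x : Fin m → ℝ => g (ecdfTail lam x) := hg.comp (measurable_ecdfTail lam)
  have hcount : Measurable fun x : Fin m → ℝ => (countLE x lam : ℝ) :=
    measurable_from_nat.comp (measurable_countLE measurable_const)
  have hset : {x : Fin m → ℝ | IsAdmissibleAt α lam K g x} =
      {x | 0 < g (ecdfTail lam x)} ∩ ({x | (countLE x lam : ℝ) ≤ lam / α * g (ecdfTail lam x)} ∩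
        {x | g (ecdfTail lam x) ≤ K * m}) :=
    Set.ext fun x => ⟨fun h => ⟨h.pos, h.countLE_le, h.le⟩, fun h => ⟨h.1, h.2.1, h.2.2⟩⟩
  rw [hset]
  exact (measurableSet_lt measurable_const hgx).inter
    ((measurableSet_le hcount (hgx.const_mul _)).inter (measurableSet_le hgx measurable_const))

variable {x : Fin m → ℝ}

-- The lower bound on the estimator makes the truncation at `lam` inactive at the number of
-- rejections.
lemma IsAdmissibleAt.adaptiveCrit_numRej (h : IsAdmissibleAt α lam K g x) (hα : 0 < α) :
    adaptiveCrit α lam g x (numRej α lam g x) = numRej α lam g x / g (ecdfTail lam x) * α := by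
  refine min_eq_left ?_
  have hR : (numRej α lam g x : ℝ) ≤ lam / α * g (ecdfTail lam x) :=
    (Nat.cast_le.2 (numRej_le_countLE x)).trans h.countLE_le
  rw [div_mul_eq_mul_div, div_le_iff₀ h.pos]
  calc (numRej α lam g x : ℝ) * α ≤ lam / α * g (ecdfTail lam x) * α := by gcongr
    _ = lam * g (ecdfTail lam x) := by field_simp

lemma IsAdmissibleAt.numRej_pos (h : IsAdmissibleAt α lam K g x) (hα : 0 < α) (hlam : 0 ≤ lam)
    {i : Fin m} (hi : x i ≤ 0) : 0 < numRej α lam g x := by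
  have hcrit : 0 ≤ adaptiveCrit α lam g x 1 := le_min (by have := h.pos; positivity) hlam
  exact le_stepUpR (Finset.card_pos.2 ⟨i, by simpa using hi.trans hcrit⟩)

end AdaptiveTest

section FalseDiscoveryRate

variable {m : ℕ} {α lam K : ℝ} {g : (Set.Ici lam → ℝ) → ℝ} {i : Fin m}

lemma integrable_rejWeight_comp {Ω : Type*} [MeasurableSpace Ω] {P : Measure Ω}
    [IsFiniteMeasure P] (hg : Measurable g) {X : Ω → Fin m → ℝ} (hX : AEMeasurable X P) :
    Integrable (fun ω => rejWeight α lam g i (X ω)) P := by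
  refine .of_bound ((measurable_rejWeight hg i).comp_aemeasurable hX).aestronglyMeasurable 1
    (ae_of_all _ fun ω => ?_)
  rw [Real.norm_of_nonneg (rejWeight_nonneg _ _)]
  exact rejWeight_le_one _ _

-- Let `R` be the number of rejections when `x i = 0`. Every `t ≤ (R / m̂₀) α` leaves `R` unchanged
-- and has weight `1 / R`, so `R` cancels and the integral is at least `α / m̂₀`.
lemma IsAdmissibleAt.le_setIntegral_rejWeight_update {x : Fin m → ℝ}
    (h : IsAdmissibleAt α lam K g (Function.update x i 0)) (hg : Measurable g) (hα : 0 < α)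
    (hlam : lam ∈ Set.Icc (0 : ℝ) 1) :
    α / (K * m) ≤ ∫ t in Set.Icc (0 : ℝ) 1, rejWeight α lam g i (Function.update x i t) := by
  set R := numRej α lam g (Function.update x i 0)
  set c := adaptiveCrit α lam g (Function.update x i 0) R
  have hRpos : 0 < R := h.numRej_pos (i := i) hα hlam.1 (by simp)
  have hc_eq : c = R / g (ecdfTail lam (Function.update x i 0)) * α := h.adaptiveCrit_numRej hα
  have hc0 : 0 ≤ c := by
    have := h.pos
    rw [hc_eq]
    positivity
  have hclam : c ≤ lam := adaptiveCrit_le _ _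
  have hweight : ∀ t ∈ Set.Icc 0 c, rejWeight α lam g i (Function.update x i t) = (R : ℝ)⁻¹ := by
    intro t ht
    rw [rejWeight, numRej_update_eq x i ht.1 ht.2,
      adaptiveCrit_update_eq x i (ht.2.trans hclam) hlam.1, if_pos (by simpa using ht.2)]
  calc α / (K * m) ≤ α / g (ecdfTail lam (Function.update x i 0)) :=
        div_le_div_of_nonneg_left hα.le h.pos h.le
    _ = c * (R : ℝ)⁻¹ := by
        rw [hc_eq]
        field_simp
    _ = ∫ t in Set.Icc 0 c, rejWeight α lam g i (Function.update x i t) := by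
        rw [setIntegral_congr_fun measurableSet_Icc hweight, setIntegral_const, smul_eq_mul,
          Real.volume_real_Icc_of_le hc0, sub_zero]
    _ ≤ ∫ t in Set.Icc 0 1, rejWeight α lam g i (Function.update x i t) :=
        setIntegral_mono_set (integrable_rejWeight_comp hg (by fun_prop))
          (ae_of_all _ fun _ => rejWeight_nonneg _ _)
          (Set.Icc_subset_Icc_right (hclam.trans hlam.2)).eventuallyLE

variable {Ω : Type*} [MeasurableSpace Ω] {P : Measure Ω} {X : Ω → Fin m → ℝ}

lemma HasUniformCoord.ae_isAdmissibleAt_update_zero [SFinite P] (hX : HasUniformCoord P X i)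
    (hg : Measurable g) (hlam : lam ∈ Set.Ioc (0 : ℝ) 1)
    (hadm : ∀ᵐ ω ∂P, IsAdmissibleAt α lam K g (X ω)) :
    ∀ᵐ ω ∂P, IsAdmissibleAt α lam K g (Function.update (X ω) i 0) := by
  filter_upwards [Measure.ae_ae_of_ae_prod (hX.ae_snd (measurableSet_isAdmissibleAt hg) hadm)]
    with ω hω
  have : (ae (volume.restrict (Set.Icc 0 lam))).NeBot := by
    rw [ae_restrict_neBot, Real.volume_Icc, sub_zero]
    exact (ENNReal.ofReal_pos.2 hlam.1).ne'
  obtain ⟨t, ht, htlam⟩ := ((ae_restrict_of_ae_restrict_of_subset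
    (Set.Icc_subset_Icc_right hlam.2) hω).and (ae_restrict_mem measurableSet_Icc)).exists
  exact ht.update htlam.2 hlam.1.le

lemma HasUniformCoord.le_integral_rejWeight [IsProbabilityMeasure P] (hX : HasUniformCoord P X i)
    (hg : Measurable g) (hα : 0 < α) (hlam : lam ∈ Set.Ioc (0 : ℝ) 1)
    (hadm : ∀ᵐ ω ∂P, IsAdmissibleAt α lam K g (X ω)) :
    α / (K * m) ≤ ∫ ω, rejWeight α lam g i (X ω) ∂P := by
  have hint : Integrable (fun q : Ω × ℝ => rejWeight α lam g i (Function.update (X q.1) i q.2))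
      (P.prod (volume.restrict (Set.Icc 0 1))) :=
    integrable_rejWeight_comp hg hX.aemeasurable_snd
  calc α / (K * m) = ∫ _, α / (K * m) ∂P := by simp
    _ ≤ ∫ ω, (∫ t in Set.Icc (0 : ℝ) 1, rejWeight α lam g i (Function.update (X ω) i t)) ∂P := by
        refine integral_mono_ae (integrable_const _) hint.integral_prod_left ?_
        filter_upwards [hX.ae_isAdmissibleAt_update_zero hg hlam hadm] with ω hω
        exact hω.le_setIntegral_rejWeight_update hg hα ⟨hlam.1.le, hlam.2⟩
    _ = ∫ q, rejWeight α lam g i (Function.update (X q.1) i q.2)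
          ∂P.prod (volume.restrict (Set.Icc 0 1)) := (integral_prod _ hint).symm
    _ = ∫ ω, rejWeight α lam g i (X ω) ∂P :=
        (hX.comp (measurable_rejWeight hg i)).integral_eq.symm

lemma card_mul_le_integral_fdp [IsProbabilityMeasure P] {I0 : Finset (Fin m)}
    (hX : ∀ i ∈ I0, HasUniformCoord P X i) (hg : Measurable g) (hα : 0 < α)
    (hlam : lam ∈ Set.Ioc (0 : ℝ) 1) (hadm : ∀ᵐ ω ∂P, IsAdmissibleAt α lam K g (X ω)) :
    I0.card * (α / (K * m)) ≤ ∫ ω, fdp α lam g I0 (X ω) ∂P := by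
  simp only [fdp_eq_sum_rejWeight]
  rw [integral_finsetSum _ fun i hi => integrable_rejWeight_comp hg (hX i hi).aemeasurable_fst,
    ← nsmul_eq_mul]
  exact Finset.card_nsmul_le_sum _ _ _ fun i hi =>
    (hX i hi).le_integral_rejWeight hg hα hlam hadm

end FalseDiscoveryRate

section FewRejections

variable {m : ℕ} {α lam K : ℝ} {g : (Set.Ici lam → ℝ) → ℝ}

lemma isRaisingClosed_numRej_le_and_le_countLE (C n : ℝ) (i : Fin m) :
    IsRaisingClosed lam i
      {x : Fin m → ℝ | (numRej α lam g x : ℝ) ≤ C ∧ n ≤ (countLE x lam : ℝ)} := by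
  rintro x s t hst ht ⟨hR, hN⟩
  refine ⟨le_trans (Nat.cast_le.2 (numRej_update_anti x i hst ht)) hR, ?_⟩
  rwa [countLE_update_eq x i ht (hst.trans ht)]

-- The critical value at the number of rejections is at most `(C / m̂₀) α ≤ (C / n) lam`.
lemma IsAdmissibleAt.numFalseRej_eq_zero {x : Fin m → ℝ} (h : IsAdmissibleAt α lam K g x)
    (hα : 0 < α) {C n : ℝ} (hn : 0 < n) (hR : (numRej α lam g x : ℝ) ≤ C)
    (hN : n ≤ (countLE x lam : ℝ)) {I0 : Finset (Fin m)} (hI0 : ∀ i ∈ I0, C / n * lam < x i) :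
    numFalseRej α lam g I0 x = 0 := by
  have hlower : n * α ≤ lam * g (ecdfTail lam x) := by
    calc n * α ≤ lam / α * g (ecdfTail lam x) * α := by
          have := hN.trans h.countLE_le
          gcongr
      _ = lam * g (ecdfTail lam x) := by field_simp
  have hcrit : adaptiveCrit α lam g x (numRej α lam g x) ≤ C / n * lam := by
    have hpos := h.pos
    have : 0 ≤ C := (Nat.cast_nonneg _).trans hR
    calc adaptiveCrit α lam g x (numRej α lam g x)
        = numRej α lam g x / g (ecdfTail lam x) * α := h.adaptiveCrit_numRej hα
      _ ≤ C / g (ecdfTail lam x) * α := by gcongr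
      _ ≤ C / n * lam := by
        rw [div_mul_eq_mul_div, div_mul_eq_mul_div, div_le_div_iff₀ hpos hn]
        nlinarith
  exact Finset.card_eq_zero.2 <| Finset.filter_eq_empty_iff.2 fun i hi =>
    not_le.2 (hcrit.trans_lt (hI0 i hi))

lemma pow_mul_measure_numRej_le_le {Ω : Type*} [MeasurableSpace Ω] {P : Measure Ω} [SFinite P]
    {X : Ω → Fin m → ℝ} {I0 : Finset (Fin m)} (hX : ∀ i ∈ I0, HasUniformCoord P X i)
    (hg : Measurable g) (hα : 0 < α) (hlam : lam ∈ Set.Icc (0 : ℝ) 1)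
    (hadm : ∀ᵐ ω ∂P, IsAdmissibleAt α lam K g (X ω)) {C n : ℝ} (hC : 0 ≤ C) (hn : 0 < n)
    (hCn : C ≤ n) :
    ENNReal.ofReal (1 - C / n) ^ I0.card *
        P {ω | (numRej α lam g (X ω) : ℝ) ≤ C ∧ n ≤ (countLE (X ω) lam : ℝ)} ≤
      P {ω | numFalseRej α lam g I0 (X ω) = 0} := by
  let E : Set (Fin m → ℝ) := {x | (numRej α lam g x : ℝ) ≤ C ∧ n ≤ (countLE x lam : ℝ)}
  have hR : Measurable fun x : Fin m → ℝ => (numRej α lam g x : ℝ) :=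
    measurable_from_nat.comp (measurable_numRej hg)
  have hN : Measurable fun x : Fin m → ℝ => (countLE x lam : ℝ) :=
    measurable_from_nat.comp (measurable_countLE measurable_const)
  have hE : MeasurableSet E :=
    (measurableSet_le hR measurable_const).inter (measurableSet_le measurable_const hN)
  calc ENNReal.ofReal (1 - C / n) ^ I0.card * P {ω | X ω ∈ E}
      ≤ P {ω | X ω ∈ E ∩ {x | ∀ i ∈ I0, C / n * lam < x i}} :=
        pow_mul_measure_le_inter_forall_lt hlam ⟨by positivity, div_le_one_of_le₀ hCn hn.le⟩ I0
          hX hE fun i _ => isRaisingClosed_numRej_le_and_le_countLE C n i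
    _ ≤ P {ω | numFalseRej α lam g I0 (X ω) = 0} := by
        refine measure_mono_ae ?_
        filter_upwards [hadm] with ω hω hωE
        exact hω.numFalseRej_eq_zero hα hn hωE.1.1 hωE.1.2 hωE.2

end FewRejections

section BasicIndependence

variable {Ω : Type*} [MeasurableSpace Ω] {P : Measure Ω}

lemma measureReal_sum_le_half_mean_le {ι : Type*} [Fintype ι] [IsProbabilityMeasure P]
    {Y : ι → Ω → ℝ} (hindep : iIndepFun Y P) (hY : ∀ i, AEMeasurable (Y i) P)
    (hY01 : ∀ i, ∀ᵐ ω ∂P, Y i ω ∈ Set.Icc (0 : ℝ) 1) {μ : ℝ} (hμ : 0 ≤ μ)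
    (hmean : ∀ i, ∫ ω, Y i ω ∂P = μ) :
    P.real {ω | ∑ i, Y i ω ≤ Fintype.card ι * (μ / 2)} ≤
      Real.exp (-(Fintype.card ι * (μ ^ 2 / 2))) := by
  have hsub (i : ι) : HasSubgaussianMGF (fun ω => μ - Y i ω) ((‖(1 : ℝ) - 0‖₊ / 2) ^ 2) P := by
    convert! (hasSubgaussianMGF_of_mem_Icc (hY i) (hY01 i)).neg using 1
    ext ω
    simp [hmean]
  have hindep' : iIndepFun (fun i ω => μ - Y i ω) P :=
    hindep.comp (fun _ y => μ - y) fun _ => by fun_prop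
  have hset : {ω | ∑ i, Y i ω ≤ Fintype.card ι * (μ / 2)} =
      {ω | Fintype.card ι * (μ / 2) ≤ ∑ i, (μ - Y i ω)} := by
    ext ω
    simp only [Set.mem_ofPred_eq, Finset.sum_sub_distrib, Finset.sum_const, Finset.card_univ,
      nsmul_eq_mul]
    constructor <;> intro h <;> linarith
  rw [hset]
  refine (HasSubgaussianMGF.measure_sum_ge_le_of_iIndepFun hindep' (s := Finset.univ)
    (fun i _ => hsub i) (by positivity)).trans_eq ?_
  rcases Nat.eq_zero_or_pos (Fintype.card ι) with h0 | h0
  · simp [h0]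
  · congr 1
    simp only [sub_zero, nnnorm_one, one_div, inv_pow, Finset.sum_const, Finset.card_univ,
      nsmul_eq_mul, NNReal.coe_mul, NNReal.coe_natCast, NNReal.coe_inv, NNReal.coe_pow,
      NNReal.coe_ofNat]
    field_simp

variable {m : ℕ} {I0 : Finset (Fin m)} {p : Fin m → Ω → ℝ}

lemma IsBI.map_eq_restrict_volume [IsProbabilityMeasure P] (h : IsBI P I0 p) {i : Fin m}
    (hi : i ∈ I0) : P.map (p i) = volume.restrict (Set.Icc 0 1) := by
  have : IsProbabilityMeasure (P.map (p i)) :=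
    Measure.isProbabilityMeasure_map (h.measurable i).aemeasurable
  refine Measure.ext_of_Iic _ _ fun t => ?_
  have hvol : volume.restrict (Set.Icc 0 1) (Set.Iic t) = ENNReal.ofReal (min t 1) := by
    rw [Measure.restrict_apply measurableSet_Iic, ← Set.Ici_inter_Iic, Set.inter_left_comm,
      Set.Iic_inter_Iic, Set.Ici_inter_Iic, Real.volume_Icc, sub_zero]
  rw [hvol, Measure.map_apply (h.measurable i) measurableSet_Iic]
  rcases lt_or_ge t 0 with ht | ht
  · have hempty : p i ⁻¹' Set.Iic t = ∅ :=
      Set.eq_empty_of_forall_notMem fun ω hω => (ht.trans_le (h.mem_Icc i ω).1).not_ge hω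
    rw [hempty, measure_empty, ENNReal.ofReal_of_nonpos ((min_le_left _ _).trans ht.le)]
  · have hmin : p i ⁻¹' Set.Iic t = {ω | p i ω ≤ min t 1} := by
      ext ω
      simp [(h.mem_Icc i ω).2]
    rw [hmin, h.unif_null i hi _ ⟨le_min ht zero_le_one, min_le_right _ _⟩]

lemma IsBI.hasUniformCoord [IsProbabilityMeasure P] (h : IsBI P I0 p) {i : Fin m} (hi : i ∈ I0) :
    HasUniformCoord P (fun ω j => p j ω) i :=
  hasUniformCoord_of_indepFun (measurable_pi_lambda _ h.measurable) (h.map_eq_restrict_volume hi)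
    (indepFun_compl_singleton_of_blocks h.measurable h.indep_blocks h.indep_null hi)

lemma IsBI.measureReal_countLE_lt_le [IsProbabilityMeasure P] (h : IsBI P I0 p) {lam : ℝ}
    (hlam : lam ∈ Set.Icc (0 : ℝ) 1) :
    P.real {ω | (countLE (fun i => p i ω) lam : ℝ) < I0.card * (lam / 2)} ≤
      Real.exp (-(I0.card * (lam ^ 2 / 2))) := by
  let Y : {i // i ∈ I0} → Ω → ℝ := fun i => {ω | p i ω ≤ lam}.indicator 1
  have hset (i : Fin m) : MeasurableSet {ω | p i ω ≤ lam} :=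
    measurableSet_le (h.measurable i) measurable_const
  have hindep : iIndepFun Y P :=
    h.indep_null.comp (fun _ => (Set.Iic lam).indicator 1) fun _ =>
      measurable_one.indicator measurableSet_Iic
  have hY01 (i : {i // i ∈ I0}) (ω : Ω) : Y i ω ∈ Set.Icc (0 : ℝ) 1 := by
    by_cases hi : p i ω ≤ lam <;> simp [Y, hi]
  have hmean (i : {i // i ∈ I0}) : ∫ ω, Y i ω ∂P = lam := by
    rw [integral_indicator_one (hset i), measureReal_def, h.unif_null i i.2 lam hlam,
      ENNReal.toReal_ofReal hlam.1]
  have hsum (ω : Ω) : ∑ i, Y i ω ≤ countLE (fun i => p i ω) lam := by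
    have hY : ∑ i, Y i ω = (I0.filter fun i => p i ω ≤ lam).card := by
      rw [Finset.sum_coe_sort I0 fun i => {ω | p i ω ≤ lam}.indicator 1 ω]
      simp [Set.indicator_apply]
    rw [hY]
    exact Nat.cast_le.2 (Finset.card_le_card (Finset.filter_subset_filter _ I0.subset_univ))
  calc P.real {ω | (countLE (fun i => p i ω) lam : ℝ) < I0.card * (lam / 2)}
      ≤ P.real {ω | ∑ i, Y i ω ≤ Fintype.card {i // i ∈ I0} * (lam / 2)} :=
        measureReal_mono fun ω hω => by
          rw [Fintype.card_coe]
          exact (hsum ω).trans (le_of_lt hω)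
    _ ≤ Real.exp (-(Fintype.card {i // i ∈ I0} * (lam ^ 2 / 2))) :=
        measureReal_sum_le_half_mean_le hindep
          (fun i => (measurable_one.indicator (hset i)).aemeasurable)
          (fun i => ae_of_all _ (hY01 i)) hlam.1 hmean
    _ = Real.exp (-(I0.card * (lam ^ 2 / 2))) := by rw [Fintype.card_coe]

end BasicIndependence

section Asymptotics

variable {Ω : ℕ → Type*} [∀ m, MeasurableSpace (Ω m)] {P : ∀ m, Measure (Ω m)}

lemma Consistent.tendsto_measure_le {F : ∀ m, Ω m → ℝ} (hF : Consistent P F) {b c : ℝ}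
    (hbc : b < c) (hc : ∀ᶠ m in atTop, c ≤ ∫ ω, F m ω ∂P m) :
    Tendsto (fun m => P m {ω | F m ω ≤ b}) atTop (𝓝 0) := by
  refine tendsto_of_tendsto_of_tendsto_of_le_of_le' tendsto_const_nhds
    (hF (c - b) (sub_pos.2 hbc)) (Eventually.of_forall fun _ => zero_le) ?_
  filter_upwards [hc] with m hm
  refine measure_mono fun ω (hω : F m ω ≤ b) => ?_
  calc c - b ≤ -(F m ω - ∫ ω', F m ω' ∂P m) := by linarith
    _ ≤ |F m ω - ∫ ω', F m ω' ∂P m| := neg_le_abs _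

lemma TendstoInftyInProb.of_tendsto_measure_div_le {R V : ∀ m, Ω m → ℝ}
    (hR : TendstoInftyInProb P R) {b : ℝ} (hb : 0 < b)
    (hVR : Tendsto (fun m => P m {ω | V m ω / R m ω ≤ b}) atTop (𝓝 0)) :
    TendstoInftyInProb P V := by
  intro C
  refine tendsto_of_tendsto_of_tendsto_of_le_of_le tendsto_const_nhds
    (by simpa using (hR (|C| / b)).add hVR) (fun _ => zero_le) fun m => ?_
  refine (measure_mono fun ω (hω : V m ω ≤ C) => ?_).trans (measure_union_le _ _)
  rcases le_or_gt (R m ω) (|C| / b) with hRC | hRC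
  · exact Or.inl hRC
  · have hRpos : 0 < R m ω := (by positivity : 0 ≤ |C| / b).trans_lt hRC
    refine Or.inr ((div_le_iff₀ hRpos).2 ?_)
    calc V m ω ≤ |C| := hω.trans (le_abs_self C)
      _ ≤ b * R m ω := ((div_lt_iff₀' hb).1 hRC).le

lemma exists_pos_eventually_le_one_sub_div_pow (t : ℝ) :
    ∃ δ : ℝ, 0 < δ ∧ ∀ᶠ n : ℕ in atTop, δ ≤ (1 - t / n) ^ n := by
  have hlim := Real.tendsto_one_add_div_pow_exp (-t)
  refine ⟨Real.exp (-t) / 2, by positivity, ?_⟩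
  filter_upwards [hlim.eventually_const_le (half_lt_self (Real.exp_pos _))] with n hn
  simpa only [neg_div, ← sub_eq_add_neg] using hn

variable {I0 : ∀ m, Finset (Fin m)} {p : ∀ m, Fin m → Ω m → ℝ} {α lam K : ℝ}
  {g : ℕ → (Set.Ici lam → ℝ) → ℝ}

lemma tendsto_measure_countLE_lt [∀ m, IsProbabilityMeasure (P m)]
    (hBI : ∀ᶠ m in atTop, IsBI (P m) (I0 m) (p m)) (hlam : lam ∈ Set.Ioc (0 : ℝ) 1)
    (hcard : Tendsto (fun m => (I0 m).card) atTop atTop) :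
    Tendsto (fun m => P m {ω | (countLE (fun i => p m i ω) lam : ℝ) < (I0 m).card * (lam / 2)})
      atTop (𝓝 0) := by
  have hexp : Tendsto (fun m => ENNReal.ofReal (Real.exp (-((I0 m).card * (lam ^ 2 / 2)))))
      atTop (𝓝 0) := by
    have hlam2 : 0 < lam ^ 2 / 2 := by have := hlam.1; positivity
    rw [← ENNReal.ofReal_zero]
    exact ENNReal.tendsto_ofReal <| Real.tendsto_exp_neg_atTop_nhds_zero.comp <|
      (tendsto_natCast_atTop_atTop.comp hcard).atTop_mul_const hlam2
  refine tendsto_of_tendsto_of_tendsto_of_le_of_le' tendsto_const_nhds hexp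
    (Eventually.of_forall fun _ => zero_le) ?_
  filter_upwards [hBI] with m hm
  rw [← ofReal_measureReal]
  exact ENNReal.ofReal_le_ofReal (hm.measureReal_countLE_lt_le ⟨hlam.1.le, hlam.2⟩)

lemma tendsto_measure_numRej_le_and_le_countLE [∀ m, IsProbabilityMeasure (P m)]
    (hBI : ∀ᶠ m in atTop, IsBI (P m) (I0 m) (p m)) (hα : 0 < α) (hlam : lam ∈ Set.Ioc (0 : ℝ) 1)
    (hcard : Tendsto (fun m => (I0 m).card) atTop atTop) (hg : ∀ᶠ m in atTop, Measurable (g m))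
    (hadm : ∀ᶠ m in atTop, ∀ᵐ ω ∂P m, IsAdmissibleAt α lam K (g m) fun i => p m i ω)
    (hV : Tendsto (fun m => P m {ω | numFalseRej α lam (g m) (I0 m) (fun i => p m i ω) = 0})
      atTop (𝓝 0)) {C : ℝ} (hC : 0 ≤ C) :
    Tendsto (fun m => P m {ω | (numRej α lam (g m) (fun i => p m i ω) : ℝ) ≤ C ∧
      (I0 m).card * (lam / 2) ≤ (countLE (fun i => p m i ω) lam : ℝ)}) atTop (𝓝 0) := by
  have hlam2 : 0 < lam / 2 := half_pos hlam.1
  obtain ⟨δ, hδ, hδpow⟩ := exists_pos_eventually_le_one_sub_div_pow (C / (lam / 2))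
  have hδ0 : ENNReal.ofReal δ ≠ 0 := (ENNReal.ofReal_pos.2 hδ).ne'
  have hlim := ENNReal.Tendsto.div_const hV (Or.inr hδ0)
  rw [ENNReal.zero_div] at hlim
  refine tendsto_of_tendsto_of_tendsto_of_le_of_le' tendsto_const_nhds hlim
    (Eventually.of_forall fun _ => zero_le) ?_
  filter_upwards [hBI, hg, hadm, hcard.eventually hδpow, hcard.eventually_gt_atTop 0,
    (tendsto_natCast_atTop_atTop.comp hcard).eventually_ge_atTop (C / (lam / 2))]
    with m hm hgm hadmm hpow hpos hlarge
  have hn : 0 < (I0 m).card * (lam / 2) := by positivity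
  have hCn : C ≤ (I0 m).card * (lam / 2) := (div_le_iff₀ hlam2).1 hlarge
  rw [ENNReal.le_div_iff_mul_le (Or.inl hδ0) (Or.inl ENNReal.ofReal_ne_top), mul_comm]
  refine le_trans ?_ (pow_mul_measure_numRej_le_le (fun i hi => hm.hasUniformCoord hi) hgm hα
    ⟨hlam.1.le, hlam.2⟩ hadmm hC hn hCn)
  gcongr
  rw [← ENNReal.ofReal_pow (sub_nonneg.2 (div_le_one_of_le₀ hCn hn.le)),
    mul_comm ((I0 m).card : ℝ), ← div_div]
  exact ENNReal.ofReal_le_ofReal hpow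

lemma tendstoInftyInProb_numRej [∀ m, IsProbabilityMeasure (P m)]
    (hBI : ∀ᶠ m in atTop, IsBI (P m) (I0 m) (p m)) (hα : 0 < α) (hlam : lam ∈ Set.Ioc (0 : ℝ) 1)
    (hcard : Tendsto (fun m => (I0 m).card) atTop atTop) (hg : ∀ᶠ m in atTop, Measurable (g m))
    (hadm : ∀ᶠ m in atTop, ∀ᵐ ω ∂P m, IsAdmissibleAt α lam K (g m) fun i => p m i ω)
    (hV : Tendsto (fun m => P m {ω | numFalseRej α lam (g m) (I0 m) (fun i => p m i ω) = 0})
      atTop (𝓝 0)) :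
    TendstoInftyInProb P fun m ω => (numRej α lam (g m) (fun i => p m i ω) : ℝ) := by
  intro C
  have hlim := (tendsto_measure_countLE_lt hBI hlam hcard).add
    (tendsto_measure_numRej_le_and_le_countLE hBI hα hlam hcard hg hadm hV (abs_nonneg C))
  rw [add_zero] at hlim
  refine tendsto_of_tendsto_of_tendsto_of_le_of_le tendsto_const_nhds hlim
    (fun _ => zero_le) fun m => ?_
  refine (measure_mono fun ω hω => ?_).trans (measure_union_le _ _)
  rcases lt_or_ge (countLE (fun i => p m i ω) lam : ℝ) ((I0 m).card * (lam / 2)) with hN | hN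
  · exact Or.inl hN
  · exact Or.inr ⟨le_trans hω (le_abs_self C), hN⟩

lemma eventually_le_integral_fdp [∀ m, IsProbabilityMeasure (P m)]
    (hBI : ∀ᶠ m in atTop, IsBI (P m) (I0 m) (p m)) (hα : 0 < α) (hlam : lam ∈ Set.Ioc (0 : ℝ) 1)
    (hK : 0 < K) {κ : ℝ} (hκ : ∀ᶠ m in atTop, κ ≤ (I0 m).card / m)
    (hg : ∀ᶠ m in atTop, Measurable (g m))
    (hadm : ∀ᶠ m in atTop, ∀ᵐ ω ∂P m, IsAdmissibleAt α lam K (g m) fun i => p m i ω) :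
    ∀ᶠ m in atTop, κ * (α / K) ≤ ∫ ω, fdp α lam (g m) (I0 m) (fun i => p m i ω) ∂P m := by
  filter_upwards [hBI, hκ, hg, hadm] with m hm hκm hgm hadmm
  calc κ * (α / K) ≤ (I0 m).card / m * (α / K) := by gcongr
    _ = (I0 m).card * (α / (K * m)) := by ring
    _ ≤ ∫ ω, fdp α lam (g m) (I0 m) (fun i => p m i ω) ∂P m :=
      card_mul_le_integral_fdp (fun _ hi => hm.hasUniformCoord hi) hgm hα hlam hadmm

lemma tendsto_card_atTop_of_le_div {κ : ℝ} (hκ : 0 < κ)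
    (h : ∀ᶠ m : ℕ in atTop, κ ≤ (I0 m).card / m) : Tendsto (fun m => (I0 m).card) atTop atTop := by
  rw [← tendsto_natCast_atTop_iff (R := ℝ)]
  refine tendsto_atTop_mono' _ ?_ (tendsto_natCast_atTop_atTop.const_mul_atTop hκ)
  filter_upwards [h, eventually_gt_atTop 0] with m hm hpos
  exact (le_div_iff₀ (Nat.cast_pos.2 hpos)).1 hm

end Asymptotics

end AdaptiveStepUp

theorem theorem4p4_general
    {Ω : ℕ → Type*} [∀ m, MeasurableSpace (Ω m)]
    {P : ∀ m, Measure (Ω m)} [∀ m, IsProbabilityMeasure (P m)]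
    {I0 : ∀ m, Finset (Fin m)} {p : ∀ m, Fin m → Ω m → ℝ}
    (hBI : ∀ᶠ m in atTop, AdaptiveStepUp.IsBI (P m) (I0 m) (p m))
    {α lam K κ : ℝ} (hα : 0 < α) (hlam : lam ∈ Set.Ioc (0 : ℝ) 1) (hK : 0 < K) (hκ : 0 < κ)
    (hcard : ∀ᶠ m in atTop, κ ≤ (I0 m).card / m)
    {g : ℕ → (Set.Ici lam → ℝ) → ℝ} (hg : ∀ᶠ m in atTop, Measurable (g m))
    (hadm : ∀ᶠ m in atTop, ∀ᵐ ω ∂P m,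
      AdaptiveStepUp.IsAdmissibleAt α lam K (g m) fun i => p m i ω)
    (hcons : AdaptiveStepUp.Consistent P fun m ω =>
      AdaptiveStepUp.fdp α lam (g m) (I0 m) fun i => p m i ω) :
    AdaptiveStepUp.TendstoInftyInProb P (fun m ω =>
      (AdaptiveStepUp.numFalseRej α lam (g m) (I0 m) (fun i => p m i ω) : ℝ)) ∧
    AdaptiveStepUp.TendstoInftyInProb P (fun m ω =>
      (AdaptiveStepUp.numRej α lam (g m) (fun i => p m i ω) : ℝ)) := by
  set c := κ * (α / K)
  have hc : 0 < c := by positivity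
  have hfdp : Tendsto (fun m => P m {ω | AdaptiveStepUp.fdp α lam (g m) (I0 m)
      (fun i => p m i ω) ≤ c / 2}) atTop (𝓝 0) :=
    hcons.tendsto_measure_le (half_lt_self hc)
      (AdaptiveStepUp.eventually_le_integral_fdp hBI hα hlam hK hcard hg hadm)
  have hV : Tendsto (fun m => P m {ω | AdaptiveStepUp.numFalseRej α lam (g m) (I0 m)
      (fun i => p m i ω) = 0}) atTop (𝓝 0) := by
    refine tendsto_of_tendsto_of_tendsto_of_le_of_le tendsto_const_nhds hfdp
      (fun _ => zero_le) fun m => measure_mono fun ω hω => ?_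
    simp only [Set.mem_ofPred_eq] at hω ⊢
    rw [AdaptiveStepUp.fdp, hω, Nat.cast_zero, zero_div]
    exact (half_pos hc).le
  have hR := AdaptiveStepUp.tendstoInftyInProb_numRej hBI hα hlam
    (AdaptiveStepUp.tendsto_card_atTop_of_le_div hκ hcard) hg hadm hV
  exact ⟨hR.of_tendsto_measure_div_le (half_pos hc) hfdp, hR⟩

theorem theorem4p4
    {Ω : ℕ → Type*} [∀ m, MeasurableSpace (Ω m)]
    (P : ∀ m, Measure (Ω m)) [∀ m, IsProbabilityMeasure (P m)]
    (I0 : ∀ m, Finset (Fin m)) (p : ∀ m, Fin m → Ω m → ℝ)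
    (hBI : ∀ m, 1 ≤ m → AdaptiveStepUp.IsBI (P m) (I0 m) (p m))
    (α₁ α₂ lam : ℝ) (hα₁ : 0 < α₁) (hα : α₁ < α₂) (hα₂ : α₂ ≤ lam) (hlam : lam < 1)
    -- the estimators of the number of true nulls, one for each `m` and each level `α`
    (g : ℕ → ℝ → (Set.Ici lam → ℝ) → ℝ)
    (hg : ∀ m, 1 ≤ m → ∀ α ∈ Set.Ioo α₁ α₂, Measurable (g m α))
    -- the proportion of true nulls converges
    (κ₀ : ℝ) (hκ₀ : κ₀ ∈ Set.Ioc (0 : ℝ) 1)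
    (hA1 : Tendsto (fun m => ((I0 m).card : ℝ) / (m : ℝ)) atTop (𝓝 κ₀))
    -- the estimators are positive and bounded below by `(α / lam) R_m(lam)`
    (hA2 : ∀ α ∈ Set.Ioo α₁ α₂, ∀ m, 1 ≤ m → ∀ ω : Ω m,
      0 < g m α (AdaptiveStepUp.ecdfTail lam fun i => p m i ω) ∧
      (AdaptiveStepUp.countLE (fun i => p m i ω) lam : ℝ) ≤
        lam / α * g m α (AdaptiveStepUp.ecdfTail lam fun i => p m i ω))
    -- the estimators are at most of order `m`
    (hA3 : ∀ α ∈ Set.Ioo α₁ α₂, ∃ K : ℝ, 0 < K ∧ ∀ m, 1 ≤ m → ∀ ω : Ω m,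
      g m α (AdaptiveStepUp.ecdfTail lam fun i => p m i ω) ≤ K * m)
    -- consistency at every level
    (hcons : ∀ α ∈ Set.Ioo α₁ α₂, AdaptiveStepUp.Consistent P fun m ω =>
      AdaptiveStepUp.fdp α lam (g m α) (I0 m) fun i => p m i ω) :
    ∀ α ∈ Set.Ioo α₁ α₂,
      AdaptiveStepUp.TendstoInftyInProb P (fun m ω =>
        (AdaptiveStepUp.numFalseRej α lam (g m α) (I0 m) (fun i => p m i ω) : ℝ)) ∧
      AdaptiveStepUp.TendstoInftyInProb P (fun m ω =>
        (AdaptiveStepUp.numRej α lam (g m α) (fun i => p m i ω) : ℝ)) := by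
  intro α hαI
  have hlam0 : 0 < lam := hα₁.trans (hα.trans_le hα₂)
  obtain ⟨K, hK, hKm⟩ := hA3 α hαI
  exact theorem4p4_general (eventually_atTop.2 ⟨1, hBI⟩) (hα₁.trans hαI.1) ⟨hlam0, hlam.le⟩ hK
    (half_pos hκ₀.1) (hA1.eventually_const_le (half_lt_self hκ₀.1))
    (eventually_atTop.2 ⟨1, fun m hm => hg m hm α hαI⟩)
    (eventually_atTop.2 ⟨1, fun m hm => ae_of_all _ fun ω =>
      ⟨(hA2 α hαI m hm ω).1, (hA2 α hαI m hm ω).2, hKm m hm ω⟩⟩) (hcons α hαI)
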